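/- Let $|\theta|_o=|\bar\theta|$, where $\bar\theta\in(-\pi,\pi]$ is the representative of $\theta\in\mathbb R$ modulo $2\pi$, and let $h(\theta)=\sin\theta/|\theta|_o$ (with $h=0$ on $2\pi\mathbb Z$) be the critical ($\alpha=\tfrac12$) singular interaction kernel. Let $K>0$, let $\Omega_1=\dots=\Omega_N$ be identical natural frequencies (e.g. $\Omega_i=0$), and let $H:\mathbb R^N\to\mathbb R^N$ be given by $$H_i(\Theta)=\Omega_i+\frac KN\sum_{j=1}^N h(\theta_j-\theta_i),\qquad i=1,\dots,N .$$ Its Filippov set-valued map is $$\mathcal H(\Theta)=\bigcap_{\delta>0}\ \bigcap_{|\mathcal N|=0}\overline{\mathrm{co}}\big(H(B_\delta(\Theta)\setminus\mathcal N)\big).$$ A Filippov solution with initial datum $\Theta_0$ is a curve $\Theta=(\theta_1,\dots,\theta_N):[0,\infty)\to\mathbb R^N$ which is absolutely continuous on bounded intervals, with $\Theta(0)=\Theta_0$ and $\dot\Theta(t)\in\mathcal H(\Theta(t))$ for a.e. $t\ge 0$. Write $D(\Theta)=\max_i\theta_i-\min_i\theta_i$. **Theorem.** Let $\Theta$ be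 a Filippov solution with initial datum $\Theta_0$ satisfying $0<D(\Theta_0)<\pi$. Then complete phase synchronization takes place in finite time, not later than $$T_c=\frac{D(\Theta_0)}{K\,h(D(\Theta_0))}:$$ there is $T\in(0,T_c]$ such that $\lim_{t\to T^-}|\theta_i(t)-\theta_j(t)|=0$ for all $i\ne j$, and $\theta_i(t)=\theta_j(t)$ for all $i,j$ and all $t\ge T$. -/

import Mathlib

open MeasureTheory Filter Topology

namespace Kuramoto

noncomputable section

/-- The representative of `θ` modulo `2π` in `(-π, π]`. -/
def rep (θ : ℝ) : ℝ := toIocMod Real.two_pi_pos (-Real.pi) θ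

/-- The orthodromic distance to zero `|θ|_o` over the unit circle. -/
def orthodromic (θ : ℝ) : ℝ := |rep θ|

/-- The singular interaction kernel `h(θ) = sin θ / |θ|_o ^ (2α)`
(with the value `0` at the multiples of `2π` when `α ≠ 0`). -/
def kernel (α θ : ℝ) : ℝ := Real.sin θ / orthodromic θ ^ (2 * α)

/-- The vector field `H_i(Θ) = Ω_i + (K / N) ∑_j h(θ_j - θ_i)` of the singular weighted
Kuramoto model with `N` oscillators. -/
def field {N : ℕ} (α K : ℝ) (Ω : Fin N → ℝ) (Θ : EuclideanSpace ℝ (Fin N)) :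
    EuclideanSpace ℝ (Fin N) :=
  WithLp.toLp 2 fun i => Ω i + K / (N : ℝ) * ∑ j, kernel α (Θ j - Θ i)

/-- The Filippov set-valued map of a single-valued map `F`:
the intersection, over all `δ > 0` and all Lebesgue-null sets `S`, of the closed convex hulls
of `F (B_δ(x) \ S)`. -/
def filippovMap {N : ℕ} (F : EuclideanSpace ℝ (Fin N) → EuclideanSpace ℝ (Fin N))
    (x : EuclideanSpace ℝ (Fin N)) : Set (EuclideanSpace ℝ (Fin N)) :=
  ⋂ (δ : ℝ) (_ : 0 < δ) (S : Set (EuclideanSpace ℝ (Fin N))) (_ : volume S = 0),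
    closure (convexHull ℝ (F '' (Metric.ball x δ \ S)))

/-- `x` is a global-in-time solution in Filippov's sense of `x' = F(x)`, `x(0) = x₀`:
it is absolutely continuous on every `[0, T]`, starts at `x₀`, and satisfies the differential
inclusion `x'(t) ∈ filippovMap F (x(t))` for almost every `t ≥ 0`.
Only the values `x t` with `t ≥ 0` are meaningful. -/
structure IsFilippovSolution {N : ℕ}
    (F : EuclideanSpace ℝ (Fin N) → EuclideanSpace ℝ (Fin N))
    (x₀ : EuclideanSpace ℝ (Fin N)) (x : ℝ → EuclideanSpace ℝ (Fin N)) : Prop where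
  absolutelyContinuous : ∀ T : ℝ, 0 < T → AbsolutelyContinuousOnInterval x 0 T
  initial : x 0 = x₀
  inclusion : ∀ᵐ t : ℝ, 0 < t → ∃ v ∈ filippovMap F (x t), HasDerivAt x v t

/-- The phase diameter `D(Θ) = max_i θ_i - min_i θ_i`. -/
def phaseDiameter {N : ℕ} (Θ : EuclideanSpace ℝ (Fin N)) : ℝ :=
  (⨆ i, Θ i) - ⨅ i, Θ i

/-- Complete phase synchronization at the finite time `T`:
`|θ_i(t) - θ_j(t)| → 0` as `t → T`, `t < T`, for all `i ≠ j`. -/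
def PhaseSynchronizesAt {N : ℕ} (Θ : ℝ → EuclideanSpace ℝ (Fin N)) (T : ℝ) : Prop :=
  ∀ i j : Fin N, i ≠ j → Tendsto (fun t => |Θ t i - Θ t j|) (𝓝[<] T) (𝓝 0)

end

end Kuramoto

/-!
At almost every time the phase diameter `D` is differentiable and its derivative is the velocity
difference between any oscillator attaining the maximal phase and any one attaining the minimal
phase. Summing over the cluster `A` of the former and the cluster `B` of the latter writes
`|A| |B| D'` as a linear functional of the velocity, and a linear functional is bounded on the
Filippov set by its bounds along `H` at nearby configurations. There the interactions inside `A`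
and inside `B` cancel because `h` is odd, so its singularity at the origin plays no role. For
`α ≥ 1/2` the kernel is decreasing on `(0, π)`, hence each remaining interaction is at least `h(D)`
in modulus and `D' ≤ -K h(D)`. By the same monotonicity `D` then decreases at least at the constant
rate `K h(D(Θ₀))` until it vanishes.
-/

namespace Kuramoto

open Set

section AbsolutelyContinuous

variable {f : ℝ → ℝ} {a b : ℝ}

theorem absolutelyContinuousOnInterval_comp_of_lipschitzWith {X Y : Type*} [PseudoMetricSpace X]
    [PseudoMetricSpace Y] {L : NNReal} {g : X → Y} (hg : LipschitzWith L g) {u : ℝ → X}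
    (hu : AbsolutelyContinuousOnInterval u a b) :
    AbsolutelyContinuousOnInterval (g ∘ u) a b := by
  have hlim := Tendsto.const_mul (L : ℝ) hu
  rw [mul_zero] at hlim
  refine squeeze_zero (fun _ => Finset.sum_nonneg fun _ _ => dist_nonneg) (fun E => ?_) hlim
  rw [Finset.mul_sum]
  exact Finset.sum_le_sum fun i _ => hg.dist_le_mul _ _

theorem sub_le_mul_of_ae_deriv_le {c : ℝ} (hab : a ≤ b)
    (hf : AbsolutelyContinuousOnInterval f a b)
    (hderiv : ∀ᵐ t : ℝ, t ∈ Ioo a b → deriv f t ≤ c) : f b - f a ≤ c * (b - a) := by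
  have hmono : ∫ t in a..b, deriv f t ≤ ∫ _ in a..b, c := by
    refine intervalIntegral.integral_mono_ae_restrict hab hf.intervalIntegrable_deriv
      intervalIntegrable_const ?_
    rw [← Measure.restrict_congr_set Ioo_ae_eq_Icc]
    exact (ae_restrict_iff' measurableSet_Ioo).2 hderiv
  rwa [hf.integral_deriv_eq_sub, intervalIntegral.integral_const, smul_eq_mul, mul_comm] at hmono

theorem antitoneOn_of_ae_deriv_nonpos_of_lt {R : ℝ} (hf : AbsolutelyContinuousOnInterval f a b)
    (hfa : f a < R) (hderiv : ∀ᵐ t : ℝ, t ∈ Ioo a b → f t < R → deriv f t ≤ 0) :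
    AntitoneOn f (Icc a b) := by
  have le_of_lt_between {s t : ℝ} (hs : s ∈ Icc a b) (ht : t ∈ Icc a b) (hst : s ≤ t)
      (hlt : ∀ u ∈ Ioo s t, f u < R) : f t ≤ f s := by
    have hac : AbsolutelyContinuousOnInterval f s t :=
      hf.mono (uIcc_subset_uIcc (Icc_subset_uIcc hs) (Icc_subset_uIcc ht))
    have hderiv_st : ∀ᵐ u : ℝ, u ∈ Ioo s t → deriv f u ≤ 0 := by
      filter_upwards [hderiv] with u hu hmem
      exact hu ⟨hs.1.trans_lt hmem.1, hmem.2.trans_le ht.2⟩ (hlt u hmem)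
    linarith [sub_le_mul_of_ae_deriv_le hst hac hderiv_st]
  have lt_bound : ∀ t ∈ Icc a b, f t < R := by
    by_contra! hexit
    have hab : a ≤ b := let ⟨_, ht, _⟩ := hexit; ht.1.trans ht.2
    have hcont : ContinuousOn f (Icc a b) := uIcc_of_le hab ▸ hf.continuousOn
    obtain ⟨m, ⟨hm, hRm⟩, hfirst⟩ := (isCompact_Icc.of_isClosed_subset
      (hcont.preimage_isClosed_of_isClosed isClosed_Icc isClosed_Ici)
      inter_subset_left).exists_isLeast hexit
    refine (hRm.trans (le_of_lt_between (left_mem_Icc.2 hab) hm hm.1 fun u hu => ?_)).not_gt hfa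
    by_contra! hRu
    exact hu.2.not_ge (hfirst ⟨⟨hu.1.le, hu.2.le.trans hm.2⟩, hRu⟩)
  exact fun s hs t ht hst =>
    le_of_lt_between hs ht hst fun u hu => lt_bound u ⟨hs.1.trans hu.1.le, hu.2.le.trans ht.2⟩

theorem eq_zero_of_ae_deriv_le_neg {c : ℝ → ℝ} {R : ℝ} (hab : a ≤ b)
    (hf : AbsolutelyContinuousOnInterval f a b) (hf_nonneg : ∀ t ∈ Icc a b, 0 ≤ f t)
    (hfa : f a < R) (hc_nonneg : ∀ r ∈ Ioo 0 R, 0 ≤ c r) (hc_anti : AntitoneOn c (Ioo 0 R))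
    (hderiv : ∀ᵐ t : ℝ, t ∈ Ioo a b → f t ∈ Ioo 0 R → deriv f t ≤ -c (f t))
    (hb : f a ≤ c (f a) * (b - a)) : f b = 0 := by
  have hanti : AntitoneOn f (Icc a b) := by
    refine antitoneOn_of_ae_deriv_nonpos_of_lt hf hfa ?_
    filter_upwards [hderiv] with t ht hmem hlt
    rcases (hf_nonneg t (Ioo_subset_Icc_self hmem)).eq_or_lt with hzero | hpos
    · have hmin : IsLocalMin f t := by
        filter_upwards [Icc_mem_nhds hmem.1 hmem.2] with s hs using hzero ▸ hf_nonneg s hs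
      exact hmin.deriv_eq_zero.le
    · exact (ht hmem ⟨hpos, hlt⟩).trans (neg_nonpos.2 (hc_nonneg _ ⟨hpos, hlt⟩))
  by_contra hne
  have hfb : 0 < f b := (hf_nonneg b (right_mem_Icc.2 hab)).lt_of_ne' hne
  have hrate : ∀ᵐ t : ℝ, t ∈ Ioo a b → deriv f t ≤ -c (f a) := by
    filter_upwards [hderiv] with t ht hmem
    have hle : f t ≤ f a := hanti (left_mem_Icc.2 hab) (Ioo_subset_Icc_self hmem) hmem.1.le
    have hge : f b ≤ f t := hanti (Ioo_subset_Icc_self hmem) (right_mem_Icc.2 hab) hmem.2.le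
    have hft : f t ∈ Ioo 0 R := ⟨hfb.trans_le hge, hle.trans_lt hfa⟩
    exact (ht hmem hft).trans
      (neg_le_neg (hc_anti hft ⟨hft.1.trans_le hle, hfa⟩ hle))
  linarith [sub_le_mul_of_ae_deriv_le hab hf hrate]

end AbsolutelyContinuous

section Kernel

variable {α θ : ℝ}

theorem orthodromic_neg (θ : ℝ) : orthodromic (-θ) = orthodromic θ :=
  Real.Angle.abs_toReal_neg θ

theorem orthodromic_of_mem_Icc (hθ : θ ∈ Icc 0 Real.pi) : orthodromic θ = θ :=
  Real.Angle.abs_toReal_coe_eq_self_iff.2 hθ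

theorem kernel_odd (α : ℝ) : Function.Odd (kernel α) := fun θ => by
  rw [kernel, kernel, orthodromic_neg, Real.sin_neg, neg_div]

theorem eqOn_kernel_Ioo (α : ℝ) :
    EqOn (kernel α) (fun θ => Real.sin θ / θ ^ (2 * α)) (Ioo 0 Real.pi) := fun θ hθ => by
  rw [kernel, orthodromic_of_mem_Icc (Ioo_subset_Icc_self hθ)]

theorem kernel_pos (hθ : θ ∈ Ioo 0 Real.pi) : 0 < kernel α θ := by
  rw [eqOn_kernel_Ioo α hθ]
  exact div_pos (Real.sin_pos_of_mem_Ioo hθ) (Real.rpow_pos_of_pos hθ.1 _)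

theorem continuousAt_kernel (hθ : θ ∈ Ioo 0 Real.pi) : ContinuousAt (kernel α) θ := by
  have hquot : ContinuousAt (fun t => Real.sin t / t ^ (2 * α)) θ :=
    Real.continuous_sin.continuousAt.div (Real.continuousAt_rpow_const _ _ (.inl hθ.1.ne'))
      (Real.rpow_pos_of_pos hθ.1 _).ne'
  exact hquot.congr ((eqOn_kernel_Ioo α).symm.eventuallyEq_of_mem (isOpen_Ioo.mem_nhds hθ))

theorem antitoneOn_sin_div_self : AntitoneOn (fun θ => Real.sin θ / θ) (Ioo 0 Real.pi) := by
  have hslope := strictConcaveOn_sin_Icc.concaveOn.slope_anti (left_mem_Icc.2 Real.pi_pos.le)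
  intro r hr s hs hrs
  simpa [slope_def_field] using hslope ⟨Ioo_subset_Icc_self hr, hr.1.ne'⟩
    ⟨Ioo_subset_Icc_self hs, hs.1.ne'⟩ hrs

theorem antitoneOn_kernel (hα : 1 / 2 ≤ α) : AntitoneOn (kernel α) (Ioo 0 Real.pi) := by
  have hfactor : EqOn (fun θ => Real.sin θ / θ * θ ^ (1 - 2 * α)) (kernel α) (Ioo 0 Real.pi) := by
    intro θ hθ
    have hθ₀ : θ ≠ 0 := hθ.1.ne'
    simp only [eqOn_kernel_Ioo α hθ, Real.rpow_sub hθ.1, Real.rpow_one]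
    field_simp
  refine AntitoneOn.congr (fun r hr s hs hrs => ?_) hfactor
  exact mul_le_mul (antitoneOn_sin_div_self hr hs hrs)
    (Real.antitoneOn_rpow_Ioi_of_exponent_nonpos (by linarith) hr.1 hs.1 hrs)
    (Real.rpow_nonneg hs.1.le _) (div_nonneg (Real.sin_pos_of_mem_Ioo hr).le hr.1.le)

end Kernel

section OddInteraction

variable {ι : Type*} {G : Type*} [AddGroup G] {h : G → ℝ}

theorem sum_sum_odd_sub_eq_zero (hodd : h.Odd) (y : ι → G) (C : Finset ι) :
    ∑ i ∈ C, ∑ j ∈ C, h (y j - y i) = 0 := by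
  have hanti : ∑ i ∈ C, ∑ j ∈ C, h (y j - y i) = -∑ i ∈ C, ∑ j ∈ C, h (y j - y i) := by
    conv_rhs => rw [Finset.sum_comm]
    simp only [← Finset.sum_neg_distrib, ← hodd.eq, neg_sub]
  linarith

theorem sum_sum_odd_sub_le [Fintype ι] [DecidableEq ι] (hodd : h.Odd) {y : ι → G}
    {C : Finset ι} {m : ℝ} (hm : ∀ i ∈ C, ∀ j ∉ C, m ≤ h (y i - y j)) :
    ∑ i ∈ C, ∑ j, h (y j - y i) ≤ -(C.card * Cᶜ.card * m) :=
  calc ∑ i ∈ C, ∑ j, h (y j - y i)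
      = ∑ i ∈ C, ∑ j ∈ C, h (y j - y i) + ∑ i ∈ C, ∑ j ∈ Cᶜ, h (y j - y i) := by
        simp only [← Finset.sum_add_distrib, Finset.sum_add_sum_compl]
    _ ≤ 0 + ∑ _ ∈ C, ∑ _ ∈ Cᶜ, -m := by
        rw [sum_sum_odd_sub_eq_zero hodd]
        gcongr with i hi j hj
        rw [← neg_sub, hodd.eq]
        exact neg_le_neg (hm i hi j (Finset.mem_compl.1 hj))
    _ = -(C.card * Cᶜ.card * m) := by
        simp only [Finset.sum_const, nsmul_eq_mul]
        ring

end OddInteraction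

section FilippovMap

variable {N : ℕ} {F : EuclideanSpace ℝ (Fin N) → EuclideanSpace ℝ (Fin N)}
  {x v : EuclideanSpace ℝ (Fin N)}

theorem apply_le_of_mem_filippovMap (hv : v ∈ filippovMap F x)
    (L : EuclideanSpace ℝ (Fin N) →L[ℝ] ℝ) {c : ℝ}
    (hL : ∀ᶠ y in 𝓝 x ⊓ ae volume, L (F y) ≤ c) : L v ≤ c := by
  obtain ⟨s, hs, t, ht, hst⟩ := eventually_inf.1 hL
  obtain ⟨δ, hδ, hball⟩ := Metric.mem_nhds_iff.1 hs
  have hv_hull : v ∈ closure (convexHull ℝ (F '' (Metric.ball x δ \ tᶜ))) := by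
    simp only [filippovMap, mem_iInter] at hv
    exact hv δ hδ tᶜ ht
  refine closure_minimal (convexHull_min ?_ (convex_halfSpace_le L.toLinearMap.isLinear c))
    (isClosed_le L.continuous continuous_const) hv_hull
  rintro _ ⟨y, ⟨hy, hyt⟩, rfl⟩
  exact hst y ⟨hball hy, not_notMem.1 hyt⟩

theorem apply_le_of_mem_filippovMap_of_continuousAt (hv : v ∈ filippovMap F x)
    (L : EuclideanSpace ℝ (Fin N) →L[ℝ] ℝ) {g : EuclideanSpace ℝ (Fin N) → ℝ}
    (hg : ContinuousAt g x) (hL : ∀ᶠ y in 𝓝 x ⊓ ae volume, L (F y) ≤ g y) : L v ≤ g x := by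
  refine le_of_forall_gt_imp_ge_of_dense fun c hc => apply_le_of_mem_filippovMap hv L ?_
  filter_upwards [hL, (hg.eventually_lt_const hc).filter_mono inf_le_left] with y hy hyc
  exact hy.trans hyc.le

end FilippovMap

section PhaseDiameter

variable {N : ℕ} {x : EuclideanSpace ℝ (Fin N)} {i j : Fin N}

theorem sub_le_phaseDiameter (x : EuclideanSpace ℝ (Fin N)) (i j : Fin N) :
    x i - x j ≤ phaseDiameter x :=
  sub_le_sub (le_ciSup (finite_range fun k => x k).bddAbove i)
    (ciInf_le (finite_range fun k => x k).bddBelow j)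

theorem coord_eq_of_phaseDiameter_eq_zero (hx : phaseDiameter x = 0) (i j : Fin N) :
    x i = x j := by
  linarith [sub_le_phaseDiameter x i j, sub_le_phaseDiameter x j i]

theorem pos_of_phaseDiameter_pos (hx : 0 < phaseDiameter x) : 0 < N := by
  refine Nat.pos_of_ne_zero ?_
  rintro rfl
  simp [phaseDiameter] at hx

/-- The oscillators whose phase is maximal. Those whose phase is minimal are `leaders (-x)`. -/
noncomputable def leaders (x : EuclideanSpace ℝ (Fin N)) : Finset (Fin N) :=
  open Classical in {i | ∀ j, x j ≤ x i}

theorem mem_leaders : i ∈ leaders x ↔ ∀ j, x j ≤ x i := by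
  simp [leaders]

theorem leaders_nonempty [NeZero N] (x : EuclideanSpace ℝ (Fin N)) : (leaders x).Nonempty :=
  let ⟨i, hi⟩ := Finite.exists_max fun k => x k
  ⟨i, mem_leaders.2 hi⟩

theorem sub_eq_phaseDiameter (hi : i ∈ leaders x) (hj : j ∈ leaders (-x)) :
    x i - x j = phaseDiameter x := by
  have : Nonempty (Fin N) := ⟨i⟩
  exact le_antisymm (sub_le_phaseDiameter x i j) (sub_le_sub (ciSup_le (mem_leaders.1 hi))
    (le_ciInf fun k => neg_le_neg_iff.1 (mem_leaders.1 hj k)))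

theorem disjoint_leaders_leaders_neg (hx : 0 < phaseDiameter x) :
    Disjoint (leaders x) (leaders (-x)) :=
  Finset.disjoint_left.2 fun _ hi hi' =>
    hx.ne' ((sub_eq_phaseDiameter hi hi').symm.trans (sub_self _))

theorem phaseDiameter_nonneg [NeZero N] (x : EuclideanSpace ℝ (Fin N)) : 0 ≤ phaseDiameter x := by
  simpa only [sub_self] using sub_le_phaseDiameter x 0 0

theorem lipschitzWith_phaseDiameter [NeZero N] :
    LipschitzWith 2 (phaseDiameter : EuclideanSpace ℝ (Fin N) → ℝ) := by
  refine LipschitzWith.of_le_add_mul 2 fun x y => ?_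
  obtain ⟨i, hi⟩ := leaders_nonempty x
  obtain ⟨j, hj⟩ := leaders_nonempty (-x)
  have hcoord (k : Fin N) : |x k - y k| ≤ dist x y := by
    simpa only [dist_eq_norm, Real.norm_eq_abs] using! PiLp.norm_apply_le (x - y) k
  rw [← sub_eq_phaseDiameter hi hj, NNReal.coe_ofNat]
  linarith [abs_le.1 (hcoord i), abs_le.1 (hcoord j), sub_le_phaseDiameter y i j]

theorem deriv_phaseDiameter_eq_sub {Θ : ℝ → EuclideanSpace ℝ (Fin N)}
    {v : EuclideanSpace ℝ (Fin N)} {t : ℝ} (hΘ : HasDerivAt Θ v t)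
    (hD : DifferentiableAt ℝ (phaseDiameter ∘ Θ) t) (hi : i ∈ leaders (Θ t))
    (hj : j ∈ leaders (-Θ t)) : deriv (phaseDiameter ∘ Θ) t = v i - v j := by
  have hcoord (k : Fin N) : HasDerivAt (fun s => Θ s k) (v k) t :=
    (EuclideanSpace.proj k : _ →L[ℝ] ℝ).hasFDerivAt.comp_hasDerivAt t hΘ
  have hmin : IsLocalMin (fun s => phaseDiameter (Θ s) - (Θ s i - Θ s j)) t :=
    Eventually.of_forall fun s => by
      simpa only [sub_eq_phaseDiameter hi hj, sub_self, sub_nonneg]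
        using sub_le_phaseDiameter (Θ s) i j
  exact sub_eq_zero.1
    (hmin.hasDerivAt_eq_zero (hD.hasDerivAt.sub ((hcoord i).sub (hcoord j))))

end PhaseDiameter

section Clusters

variable {N : ℕ} {α K : ℝ} {Ω : Fin N → ℝ} {x v : EuclideanSpace ℝ (Fin N)}
  {A B C : Finset (Fin N)}

/-- The oscillators of `C` are strictly ahead of all the others. A cluster trailing behind all the
others is encoded as `IsLeadingCluster (-x) C`. -/
def IsLeadingCluster (x : EuclideanSpace ℝ (Fin N)) (C : Finset (Fin N)) : Prop :=
  ∀ i ∈ C, ∀ j ∉ C, x j < x i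

theorem isLeadingCluster_leaders (x : EuclideanSpace ℝ (Fin N)) :
    IsLeadingCluster x (leaders x) := by
  intro i hi j hj
  obtain ⟨k, hk⟩ := not_forall.1 (mem_leaders.not.1 hj)
  exact (not_le.1 hk).trans_le (mem_leaders.1 hi k)

theorem IsLeadingCluster.eventually (hC : IsLeadingCluster x C) :
    ∀ᶠ y in 𝓝 x, IsLeadingCluster y C := by
  have hcoord (k : Fin N) : Continuous fun y : EuclideanSpace ℝ (Fin N) => y k :=
    (EuclideanSpace.proj k : _ →L[ℝ] ℝ).continuous
  simp only [IsLeadingCluster, eventually_all]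
  exact fun i hi j hj =>
    (hcoord j).continuousAt.eventually_lt (hcoord i).continuousAt (hC i hi j hj)

theorem kernel_phaseDiameter_le_kernel_sub {i j : Fin N} (hα : 1 / 2 ≤ α)
    (hx : phaseDiameter x < Real.pi) (hij : x j < x i) :
    kernel α (phaseDiameter x) ≤ kernel α (x i - x j) := by
  have hpos : 0 < x i - x j := sub_pos.2 hij
  have hle := sub_le_phaseDiameter x i j
  exact antitoneOn_kernel hα ⟨hpos, hle.trans_lt hx⟩ ⟨hpos.trans_le hle, hx⟩ hle

theorem sum_field (α K : ℝ) (Ω : Fin N → ℝ) (x : EuclideanSpace ℝ (Fin N))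
    (C : Finset (Fin N)) : ∑ i ∈ C, field α K Ω x i =
      ∑ i ∈ C, Ω i + K / N * ∑ i ∈ C, ∑ j, kernel α (x j - x i) := by
  simp only [field, Finset.sum_add_distrib, Finset.mul_sum]

theorem IsLeadingCluster.sum_field_le (hα : 1 / 2 ≤ α) (hK : 0 ≤ K)
    (hx : phaseDiameter x < Real.pi) (hC : IsLeadingCluster x C) :
    ∑ i ∈ C, field α K Ω x i ≤
      ∑ i ∈ C, Ω i - K / N * (C.card * Cᶜ.card * kernel α (phaseDiameter x)) := by
  rw [sum_field, sub_eq_add_neg, ← mul_neg]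
  gcongr
  exact sum_sum_odd_sub_le (kernel_odd α) fun i hi j hj =>
    kernel_phaseDiameter_le_kernel_sub hα hx (hC i hi j hj)

theorem IsLeadingCluster.le_sum_field_of_neg (hα : 1 / 2 ≤ α) (hK : 0 ≤ K)
    (hx : phaseDiameter x < Real.pi) (hC : IsLeadingCluster (-x) C) :
    ∑ i ∈ C, Ω i + K / N * (C.card * Cᶜ.card * kernel α (phaseDiameter x)) ≤
      ∑ i ∈ C, field α K Ω x i := by
  have hreflect (i j : Fin N) : -x i - -x j = x j - x i := by ring
  have hsum : ∑ i ∈ C, ∑ j, kernel α (-x j - -x i) ≤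
      -(C.card * Cᶜ.card * kernel α (phaseDiameter x)) :=
    sum_sum_odd_sub_le (y := fun k => -x k) (kernel_odd α) fun i hi j hj => by
      rw [hreflect]
      exact kernel_phaseDiameter_le_kernel_sub hα hx (neg_lt_neg_iff.1 (hC i hi j hj))
  simp only [← neg_sub', (kernel_odd α).eq, Finset.sum_neg_distrib] at hsum
  rw [sum_field]
  gcongr
  exact neg_le_neg_iff.1 hsum

/-- The sum of the differences `v i - v j` over `i ∈ A` and `j ∈ B`, as a linear functional of the
velocity `v`: up to the factor `|A| |B|`, the gap between the mean velocities of two clusters. -/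
noncomputable def velocityGap (A B : Finset (Fin N)) : EuclideanSpace ℝ (Fin N) →L[ℝ] ℝ :=
  ∑ i ∈ A, ∑ j ∈ B, (EuclideanSpace.proj i - EuclideanSpace.proj j)

theorem velocityGap_apply (A B : Finset (Fin N)) (v : EuclideanSpace ℝ (Fin N)) :
    velocityGap A B v = ∑ i ∈ A, ∑ j ∈ B, (v i - v j) := by
  simp [velocityGap]

theorem velocityGap_eq_card_mul_sum_sub (A B : Finset (Fin N)) (v : EuclideanSpace ℝ (Fin N)) :
    velocityGap A B v = B.card * ∑ i ∈ A, v i - A.card * ∑ j ∈ B, v j := by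
  simp [velocityGap_apply, Finset.mul_sum]

theorem velocityGap_field_le [NeZero N] (hα : 1 / 2 ≤ α) (hK : 0 ≤ K) (hΩ : ∀ i j, Ω i = Ω j)
    (hx : phaseDiameter x ∈ Ioo 0 Real.pi) (hAB : Disjoint A B)
    (hA : IsLeadingCluster x A) (hB : IsLeadingCluster (-x) B) :
    velocityGap A B (field α K Ω x) ≤
      -(A.card * B.card * (K * kernel α (phaseDiameter x))) := by
  set k := kernel α (phaseDiameter x)
  have hk : 0 < k := kernel_pos hx
  have hN : (N : ℝ) ≠ 0 := NeZero.ne _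
  have hΩ_sum (C : Finset (Fin N)) : ∑ i ∈ C, Ω i = C.card * Ω 0 := by
    simp [Finset.sum_congr rfl fun i _ => hΩ i 0]
  have hcard : (N : ℝ) ≤ Aᶜ.card + Bᶜ.card := by
    have hle : B.card ≤ Aᶜ.card := Finset.card_le_card (Finset.subset_compl_iff_disjoint_left.2 hAB)
    have hadd : B.card + Bᶜ.card = N := B.card_add_card_compl.trans (Fintype.card_fin N)
    exact_mod_cast hadd.symm.le.trans (Nat.add_le_add_right hle _)
  calc velocityGap A B (field α K Ω x)
      = B.card * ∑ i ∈ A, field α K Ω x i - A.card * ∑ j ∈ B, field α K Ω x j :=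
        velocityGap_eq_card_mul_sum_sub A B _
    _ ≤ B.card * (A.card * Ω 0 - K / N * (A.card * Aᶜ.card * k)) -
          A.card * (B.card * Ω 0 + K / N * (B.card * Bᶜ.card * k)) := by
        rw [← hΩ_sum, ← hΩ_sum]
        gcongr
        · exact hA.sum_field_le hα hK hx.2
        · exact hB.le_sum_field_of_neg hα hK hx.2
    _ = -(A.card * B.card * (K / N * (Aᶜ.card + Bᶜ.card) * k)) := by ring
    _ ≤ -(A.card * B.card * (K / N * N * k)) := by gcongr
    _ = -(A.card * B.card * (K * k)) := by rw [div_mul_cancel₀ K hN]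

theorem velocityGap_le_of_mem_filippovMap [NeZero N] (hα : 1 / 2 ≤ α) (hK : 0 ≤ K)
    (hΩ : ∀ i j, Ω i = Ω j) (hx : phaseDiameter x ∈ Ioo 0 Real.pi)
    (hv : v ∈ filippovMap (field α K Ω) x) (hAB : Disjoint A B) (hA : IsLeadingCluster x A)
    (hB : IsLeadingCluster (-x) B) :
    velocityGap A B v ≤ -(A.card * B.card * (K * kernel α (phaseDiameter x))) := by
  have hD : ContinuousAt (phaseDiameter : EuclideanSpace ℝ (Fin N) → ℝ) x :=
    lipschitzWith_phaseDiameter.continuous.continuousAt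
  have hbound : ContinuousAt (fun y : EuclideanSpace ℝ (Fin N) =>
      -(A.card * B.card * (K * kernel α (phaseDiameter y)))) x :=
    (((continuousAt_kernel hx).comp hD).const_mul K |>.const_mul _).neg
  refine
    apply_le_of_mem_filippovMap_of_continuousAt hv _ hbound (Eventually.filter_mono inf_le_left ?_)
  filter_upwards [hD.eventually (isOpen_Ioo.mem_nhds hx), hA.eventually,
    (continuous_neg.tendsto x).eventually hB.eventually] with y hy hAy hBy
  exact velocityGap_field_le hα hK hΩ hy hAB hAy hBy

theorem deriv_phaseDiameter_le [NeZero N] (hα : 1 / 2 ≤ α) (hK : 0 ≤ K) (hΩ : ∀ i j, Ω i = Ω j)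
    {Θ : ℝ → EuclideanSpace ℝ (Fin N)} {t : ℝ} (hΘ : HasDerivAt Θ v t)
    (hv : v ∈ filippovMap (field α K Ω) (Θ t)) (hdiff : DifferentiableAt ℝ (phaseDiameter ∘ Θ) t)
    (hD : phaseDiameter (Θ t) ∈ Ioo 0 Real.pi) :
    deriv (phaseDiameter ∘ Θ) t ≤ -(K * kernel α (phaseDiameter (Θ t))) := by
  set A := leaders (Θ t)
  set B := leaders (-Θ t)
  have hpos : (0 : ℝ) < A.card * B.card := by
    exact_mod_cast Nat.mul_pos (leaders_nonempty _).card_pos (leaders_nonempty _).card_pos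
  have hgap : velocityGap A B v = A.card * B.card * deriv (phaseDiameter ∘ Θ) t := by
    rw [velocityGap_apply, Finset.sum_congr rfl fun i hi => Finset.sum_congr rfl fun j hj =>
      (deriv_phaseDiameter_eq_sub hΘ hdiff hi hj).symm]
    simp only [Finset.sum_const, nsmul_eq_mul, mul_assoc, A, B]
  refine le_of_mul_le_mul_left ?_ hpos
  rw [← hgap, mul_neg]
  exact velocityGap_le_of_mem_filippovMap hα hK hΩ hD hv (disjoint_leaders_leaders_neg hD.1)
    (isLeadingCluster_leaders _) (isLeadingCluster_leaders _)

end Clusters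

namespace IsFilippovSolution

variable {N : ℕ} {Θ₀ : EuclideanSpace ℝ (Fin N)} {Θ : ℝ → EuclideanSpace ℝ (Fin N)} {t : ℝ}

theorem continuousAt {F : EuclideanSpace ℝ (Fin N) → EuclideanSpace ℝ (Fin N)}
    (hΘ : IsFilippovSolution F Θ₀ Θ) (ht : 0 < t) : ContinuousAt Θ t := by
  have hcont := (hΘ.absolutelyContinuous (t + 1) (by linarith)).continuousOn
  rw [uIcc_of_le (by linarith)] at hcont
  exact hcont.continuousAt (Icc_mem_nhds ht (by linarith))

theorem phaseDiameter_eq_zero {α K : ℝ} {Ω : Fin N → ℝ} (hα : 1 / 2 ≤ α) (hK : 0 < K)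
    (hΩ : ∀ i j, Ω i = Ω j) (hΘ : IsFilippovSolution (field α K Ω) Θ₀ Θ)
    (hD : phaseDiameter Θ₀ ∈ Ioo 0 Real.pi)
    (ht : phaseDiameter Θ₀ / (K * kernel α (phaseDiameter Θ₀)) ≤ t) :
    phaseDiameter (Θ t) = 0 := by
  have : NeZero N := .of_pos (pos_of_phaseDiameter_pos hD.1)
  have hrate : 0 < K * kernel α (phaseDiameter Θ₀) := mul_pos hK (kernel_pos hD)
  have ht_pos : 0 < t := (div_pos hD.1 hrate).trans_le ht
  have hac : AbsolutelyContinuousOnInterval (phaseDiameter ∘ Θ) 0 t :=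
    absolutelyContinuousOnInterval_comp_of_lipschitzWith lipschitzWith_phaseDiameter
      (hΘ.absolutelyContinuous t ht_pos)
  refine eq_zero_of_ae_deriv_le_neg (f := phaseDiameter ∘ Θ) (c := fun r => K * kernel α r)
    ht_pos.le hac (fun s _ => phaseDiameter_nonneg (Θ s)) ?_
    (fun r hr => (mul_pos hK (kernel_pos hr)).le)
    (fun r hr s hs hrs => mul_le_mul_of_nonneg_left (antitoneOn_kernel hα hr hs hrs) hK.le) ?_ ?_
  · simpa only [Function.comp_apply, hΘ.initial] using hD.2
  · filter_upwards [hΘ.inclusion, hac.ae_differentiableAt] with s hincl hdiff hs hDs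
    obtain ⟨v, hv, hderiv⟩ := hincl hs.1
    exact deriv_phaseDiameter_le hα hK.le hΩ hderiv hv
      (hdiff (Icc_subset_uIcc (Ioo_subset_Icc_self hs))) hDs
  · simpa only [Function.comp_apply, hΘ.initial, sub_zero] using (div_le_iff₀' hrate).1 ht

end IsFilippovSolution

theorem phaseSynchronizesAt_of_continuousAt {N : ℕ} {Θ : ℝ → EuclideanSpace ℝ (Fin N)} {T : ℝ}
    (hΘ : ContinuousAt Θ T) (hT : ∀ i j, Θ T i = Θ T j) : PhaseSynchronizesAt Θ T := by
  intro i j _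
  have hcoord (k : Fin N) : ContinuousAt (fun t => Θ t k) T :=
    (EuclideanSpace.proj k : _ →L[ℝ] ℝ).continuous.continuousAt.comp hΘ
  have hlim : Tendsto (fun t => |Θ t i - Θ t j|) (𝓝 T) (𝓝 |Θ T i - Θ T j|) :=
    ((hcoord i).sub (hcoord j)).abs
  rw [hT i j, sub_self, abs_zero] at hlim
  exact hlim.mono_left nhdsWithin_le_nhds

end Kuramoto

theorem mainTheorem10_general (N : ℕ) (α K : ℝ) (hα : 1 / 2 ≤ α) (hK : 0 < K)
    (Ω : Fin N → ℝ) (hΩ : ∀ i j, Ω i = Ω j)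
    (Θ₀ : EuclideanSpace ℝ (Fin N))
    (hD_pos : 0 < Kuramoto.phaseDiameter Θ₀)
    (hD_lt : Kuramoto.phaseDiameter Θ₀ < Real.pi)
    (Θ : ℝ → EuclideanSpace ℝ (Fin N))
    (hΘ : Kuramoto.IsFilippovSolution (Kuramoto.field α K Ω) Θ₀ Θ) :
    ∃ T : ℝ, 0 < T ∧
      T ≤ Kuramoto.phaseDiameter Θ₀ /
        (K * Kuramoto.kernel α (Kuramoto.phaseDiameter Θ₀)) ∧
      Kuramoto.PhaseSynchronizesAt Θ T ∧
      ∀ t : ℝ, T ≤ t → ∀ i j : Fin N, Θ t i = Θ t j := by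
  set T := Kuramoto.phaseDiameter Θ₀ / (K * Kuramoto.kernel α (Kuramoto.phaseDiameter Θ₀))
  have hT : 0 < T := div_pos hD_pos (mul_pos hK (Kuramoto.kernel_pos ⟨hD_pos, hD_lt⟩))
  have hsync (t : ℝ) (ht : T ≤ t) : ∀ i j, Θ t i = Θ t j :=
    Kuramoto.coord_eq_of_phaseDiameter_eq_zero
      (hΘ.phaseDiameter_eq_zero hα hK hΩ ⟨hD_pos, hD_lt⟩ ht)
  exact ⟨T, hT, le_rfl,
    Kuramoto.phaseSynchronizesAt_of_continuousAt (hΘ.continuousAt hT) (hsync T le_rfl), hsync⟩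

theorem mainTheorem10 (N : ℕ) (K : ℝ) (hK : 0 < K)
    (Ω : Fin N → ℝ) (hΩ : ∀ i j, Ω i = Ω j)
    (Θ₀ : EuclideanSpace ℝ (Fin N))
    (hD_pos : 0 < Kuramoto.phaseDiameter Θ₀)
    (hD_lt : Kuramoto.phaseDiameter Θ₀ < Real.pi)
    (Θ : ℝ → EuclideanSpace ℝ (Fin N))
    (hΘ : Kuramoto.IsFilippovSolution (Kuramoto.field (1 / 2) K Ω) Θ₀ Θ) :
    ∃ T : ℝ, 0 < T ∧
      T ≤ Kuramoto.phaseDiameter Θ₀ /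
        (K * Kuramoto.kernel (1 / 2) (Kuramoto.phaseDiameter Θ₀)) ∧
      Kuramoto.PhaseSynchronizesAt Θ T ∧
      ∀ t : ℝ, T ≤ t → ∀ i j : Fin N, Θ t i = Θ t j :=
  mainTheorem10_general N (1 / 2) K le_rfl hK Ω hΩ Θ₀ hD_pos hD_lt Θ hΘ
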